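/- Theorem 4.4 (Multivariable Petermichl Bilinear Embedding). Notation. Let $\mathcal D^n$ be the collection of dyadic cubes $Q=\prod_{i=1}^n[m_i2^{-k},(m_i+1)2^{-k})$ ($k,m_i\in\mathbb Z$) of $\mathbb R^n$, and let $\mathcal D^n(Q')$ be the set of all $Q\in\mathcal D^n$ with $Q\subseteq Q'$. For $Q\in\mathcal D^n$ and $1\le j\le 2^n-1$ the Wilson sets $E^1_{j,Q},E^2_{j,Q}$ are defined by induction on $n$: write $Q=\widetilde Q\times I$ with $\widetilde Q\in\mathcal D^{n-1}$ and $I$ a dyadic interval with left and right halves $I_-,I_+$; then $(E^1_{1,Q},E^2_{1,Q})=(\widetilde Q\times I_-,\widetilde Q\times I_+)$, and for $1\le j\le 2^{n-1}-1$ and $l=1,2$, $E^l_{2j,Q}=E^l_{j,\widetilde Q}\times I_-$ and $E^l_{2j+1,Q}=E^l_{j,\widetilde Q}\times I_+$. Put $E_{j,Q}=E^1_{j,Q}\cup E^2_{j,Q}$. A weight is a locally integrable, almost everywhere positive function $w$ on $\mathbb R^n$; $\langle w\rangle_E=\frac1{|E|}\int_E w\,dx$ and $\langle f\rangle_{E,w}=\frac{\int_E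 f\,w\,dx}{\int_E w\,dx}$; $L^2_{\mathbb R^n}(w)$ is the space of real functions that are square integrable with respect to $w\,dx$. Statement. There is an absolute constant $C>0$ (in particular independent of $n$) such that the following holds for every $n$. Let $w,v$ be weights on $\mathbb R^n$, let $\{\alpha_{j,Q}\}$, $Q\in\mathcal D^n$, $1\le j\le 2^n-1$, be nonnegative numbers and let $A>0$ be such that for all $Q'\in\mathcal D^n$ and $i=1,\dots,2^n-1$ $$\frac1{|E_{i,Q'}|}\sum_{Q\in\mathcal D^n(Q')}\ \sum_{j:E_{j,Q}\subseteq E_{i,Q'}}\frac{\alpha_{j,Q}}{\langle w\rangle_{E_{j,Q}}}\le A\langle v\rangle_{E_{i,Q'}},$$ $$\frac1{|E_{i,Q'}|}\sum_{Q\in\mathcal D^n(Q')}\ \sum_{j:E_{j,Q}\subseteq E_{i,Q'}}\frac{\alpha_{j,Q}}{\langle v\rangle_{E_{j,Q}}}\le A\langle w\rangle_{E_{i,Q'}},$$ $$\frac1{|E_{i,Q'}|}\sum_{Q\in\mathcal D^n(Q')}\ \sum_{j:E_{j,Q}\subseteq E_{i,Q'}}\alpha_{j,Q}\le A.$$ Then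 for all $f\in L^2_{\mathbb R^n}(w)$, $g\in L^2_{\mathbb R^n}(v)$ and all $Q'\in\mathcal D^n$ the series below converges absolutely and $$\sum_{Q\in\mathcal D^n(Q')}\sum_{j=1}^{2^n-1}\alpha_{j,Q}\langle f\rangle_{E_{j,Q},w}\langle g\rangle_{E_{j,Q},v}\le C\,A\,\|f\|_{L^2_{\mathbb R^n}(w)}\|g\|_{L^2_{\mathbb R^n}(v)}.$$ -/

import Mathlib

open MeasureTheory
open scoped ENNReal

/-- The dyadic interval `[m 2⁻ᵏ, (m + 1) 2⁻ᵏ)` of the real line. -/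
def dyadicInterval (k m : ℤ) : Set ℝ :=
  Set.Ico ((m : ℝ) * (2 : ℝ) ^ (-k)) (((m : ℝ) + 1) * (2 : ℝ) ^ (-k))

/-- The collection of all dyadic cubes of `ℝⁿ`: the cube with parameters `k`, `m` has side length
`2⁻ᵏ` and lower corner `2⁻ᵏ m`. -/
@[ext]
structure DyadicCube (n : ℕ) where
  k : ℤ
  m : Fin n → ℤ

namespace DyadicCube

/-- The cube as a subset of `ℝⁿ`. -/
def carrier {n : ℕ} (Q : DyadicCube n) : Set (Fin n → ℝ) :=
  {x | ∀ i, x i ∈ dyadicInterval Q.k (Q.m i)}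

/-- The collection of all dyadic subcubes of `Q` (including `Q`). -/
def subcubes {n : ℕ} (Q : DyadicCube n) : Set (DyadicCube n) :=
  {R | R.carrier ⊆ Q.carrier}

/-- The `n`-dimensional cube `Q̃` in the decomposition `Q = Q̃ × I`, where `I` is the dyadic interval
in the last coordinate. -/
def base {n : ℕ} (Q : DyadicCube (n + 1)) : DyadicCube n :=
  ⟨Q.k, fun i => Q.m i.castSucc⟩

/-- The left (`b = 0`) and the right (`b = 1`) half of the last edge `I` of the cube
`Q = Q̃ × I`. -/
def lastHalf {n : ℕ} (Q : DyadicCube (n + 1)) (b : ℕ) : Set ℝ :=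
  dyadicInterval (Q.k + 1) (2 * Q.m (Fin.last n) + (b : ℤ))

end DyadicCube

/-- The Wilson sets: `wilsonHalf b n Q j` is `E¹_{j,Q}` for `b = 0` and `E²_{j,Q}` for `b = 1`,
where `1 ≤ j ≤ 2ⁿ - 1` (for other values of `j` the set is empty). With `Q = Q̃ × I`, the first pair
is `(Q̃ × I₋, Q̃ × I₊)`; the pairs number `2 j` and `2 j + 1` are the products of the pair number `j`
of `Q̃` with `I₋` and with `I₊`. -/
def wilsonHalf (b : Fin 2) : (n : ℕ) → DyadicCube n → ℕ → Set (Fin n → ℝ)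
  | 0, _, _ => ∅
  | n + 1, Q, j =>
    if j = 1 then
      {x | (fun i : Fin n => x i.castSucc) ∈ Q.base.carrier ∧ x (Fin.last n) ∈ Q.lastHalf b}
    else
      {x | (fun i : Fin n => x i.castSucc) ∈ wilsonHalf b n Q.base (j / 2) ∧
        x (Fin.last n) ∈ Q.lastHalf (j % 2)}

/-- `E_{j,Q} = E¹_{j,Q} ∪ E²_{j,Q}`. -/
def wilsonSet {n : ℕ} (Q : DyadicCube n) (j : ℕ) : Set (Fin n → ℝ) :=
  wilsonHalf 0 n Q j ∪ wilsonHalf 1 n Q j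

/-- A weight: a locally integrable, almost everywhere positive function on `ℝⁿ`. -/
structure IsWeight {n : ℕ} (w : (Fin n → ℝ) → ℝ) : Prop where
  locallyIntegrable : LocallyIntegrable w volume
  ae_pos : ∀ᵐ x ∂(volume : Measure (Fin n → ℝ)), 0 < w x

/-- The measure `w dx`. -/
noncomputable def weightMeasure {n : ℕ} (w : (Fin n → ℝ) → ℝ) : Measure (Fin n → ℝ) :=
  volume.withDensity (fun x => ENNReal.ofReal (w x))

/-- The norm of `f` in `L²(w)`. -/
noncomputable def weightedL2Norm {n : ℕ} (w f : (Fin n → ℝ) → ℝ) : ℝ :=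
  (eLpNorm f 2 (weightMeasure w)).toReal

/-- The average `⟨w⟩_E` with respect to Lebesgue measure. -/
noncomputable def avg {n : ℕ} (w : (Fin n → ℝ) → ℝ) (E : Set (Fin n → ℝ)) : ℝ :=
  ⨍ x in E, w x

/-- The weighted average `⟨f⟩_{E,w} = w(E)⁻¹ ∫_E f w dx`. -/
noncomputable def weightedAvg {n : ℕ} (w f : (Fin n → ℝ) → ℝ) (E : Set (Fin n → ℝ)) : ℝ :=
  (∫ x in E, f x * w x) / ∫ x in E, w x

open Classical in
/-- For nonnegative `β`, the quantity `|E_{i,Q'}|⁻¹ ∑_{Q ∈ 𝒟(Q')} ∑_{j : E_{j,Q} ⊆ E_{i,Q'}} β_{j,Q}`,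
as an element of `[0, ∞]`. -/
noncomputable def carlesonAverage {n : ℕ} (β : DyadicCube n → ℕ → ℝ) (Q' : DyadicCube n)
    (i : ℕ) : ℝ≥0∞ :=
  (volume (wilsonSet Q' i))⁻¹ *
    ∑' Q : Q'.subcubes,
      ∑ j ∈ (Finset.Icc 1 (2 ^ n - 1)).filter (fun j => wilsonSet Q.1 j ⊆ wilsonSet Q' i),
        ENNReal.ofReal (β Q.1 j)

/-! The Wilson sets of all cubes together form a laminar family: any two are nested or disjoint. The
geometry enters only through this fact and the Carleson conditions, so the dimension never appears
in the constant.

For a finite laminar family the proof is a Bellman induction. Maximising `bellmanLin` over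
nonnegative `p`, `q`, `p'`, `q'` gives a function of the integrals of `f w`, `g v`, `w`, `v` and of
three Carleson masses `S`, `N`, `M`. It is kept in linearised form: with the parameters fixed it is
linear in these seven quantities, all of which are additive over disjoint pieces, so estimates on
disjoint pieces simply add up. What remains is the effect of a set's own coefficient `α` on the
masses; `bellmanLin_jump` shows that this pays for `α` times the two averages, up to the factor 8.
With empty family the function is at most `2 ∫ f² w + 2 ∫ g² v`, and this bound is carried up by
`laminar_bellman`.

`laminar_bilinear_embedding` turns the resulting sum of two squared norms into their product by
scaling `f`. The theorem follows by applying it to `|f|` and `|g|` on finite subfamilies, with a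
bound independent of the subfamily. -/

/-! ### The Bellman function and its jump inequality -/

/-- The linearised Bellman function of the bilinear embedding. -/
def bellmanLin (x y r v S N M p q p' q' : ℝ) : ℝ :=
  2 * (p + p') * x + 2 * (q + q') * y - (p ^ 2 + p' ^ 2) * r - (q ^ 2 + q' ^ 2) * v
    - 2 * p * q * S - p' ^ 2 * N - q' ^ 2 * M

/-- Here `F`, `G` are the weighted averages. The hypothesis `h` holds for all parameters before the
jump, so it may be used at better parameters than those in the conclusion. The masses enter with
coefficients `2 p q`, `p' ^ 2`, `q' ^ 2`, and the gain is `α (2 p q + p' ^ 2 ℓ / v + q' ^ 2 ℓ / r)`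
at the parameters chosen. It suffices to make one of the three terms at least `α F G / 8`. -/
theorem bellmanLin_jump {F G r v ℓ S N M α D : ℝ} (hF : 0 ≤ F) (hG : 0 ≤ G) (hr : 0 < r)
    (hv : 0 < v) (hℓ : 0 < ℓ) (hα : 0 ≤ α) (hS0 : 0 ≤ S) (hN0 : 0 ≤ N) (hM0 : 0 ≤ M)
    (hS : α + S ≤ ℓ) (hN : α * ℓ / v + N ≤ r) (hM : α * ℓ / r + M ≤ v)
    (h : ∀ p q p' q' : ℝ, 0 ≤ p → 0 ≤ q → 0 ≤ p' → 0 ≤ q' →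
      bellmanLin (F * r) (G * v) r v S N M p q p' q' ≤ D)
    {p q p' q' : ℝ} (hp : 0 ≤ p) (hq : 0 ≤ q) :
    bellmanLin (F * r) (G * v) r v (α + S) (α * ℓ / v + N) (α * ℓ / r + M) p q p' q'
      + α * F * G / 8 ≤ D := by
  set a := ℓ / v with ha
  set b := ℓ / r with hb
  have ha0 : 0 < a := by positivity
  have hb0 : 0 < b := by positivity
  have e1 : α * ℓ / v = α * a := by rw [ha]; ring
  have e2 : α * ℓ / r = α * b := by rw [hb]; ring
  have hav : a * v = ℓ := by rw [ha]; field_simp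
  have hbr : b * r = ℓ := by rw [hb]; field_simp
  rw [e1] at hN ⊢
  rw [e2] at hM ⊢
  -- The maximiser of the concave quadratic in `t`; the Carleson bound `N ≤ r` keeps it above `F /
  -- 2`.
  have opt : ∀ {F r N t : ℝ}, 0 ≤ F → 0 < r → 0 ≤ N → N ≤ r →
      ∃ u, F / 2 ≤ u ∧ 2 * t * (F * r) - t ^ 2 * (r + N) ≤ 2 * u * (F * r) - u ^ 2 * (r + N) := by
    intro F r N t hF hr hN hNr
    refine ⟨F * r / (r + N), ?_, ?_⟩
    · rw [div_le_div_iff₀ (by norm_num) (by positivity)]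
      nlinarith
    · have hrN : 0 < r + N := by positivity
      have : 2 * (F * r / (r + N)) * (F * r) - (F * r / (r + N)) ^ 2 * (r + N)
          - (2 * t * (F * r) - t ^ 2 * (r + N)) = (r + N) * (t - F * r / (r + N)) ^ 2 := by
        field_simp
        ring
      linarith [mul_nonneg hrN.le (sq_nonneg (t - F * r / (r + N)))]
  obtain ⟨P, hP, hP'⟩ := opt (t := p') hF hr (add_nonneg (mul_nonneg hα ha0.le) hN0) hN
  obtain ⟨Q, hQ, hQ'⟩ := opt (t := q') hG hv (add_nonneg (mul_nonneg hα hb0.le) hM0) hM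
  have hP0 : 0 ≤ P := by linarith
  have hQ0 : 0 ≤ Q := by linarith
  have hPP : F ^ 2 / 4 ≤ P ^ 2 := by nlinarith
  have hQQ : G ^ 2 / 4 ≤ Q ^ 2 := by nlinarith
  suffices hmain : ∃ p₁ q₁ : ℝ, 0 ≤ p₁ ∧ 0 ≤ q₁ ∧
      2 * p * (F * r) + 2 * q * (G * v) - p ^ 2 * r - q ^ 2 * v - 2 * p * q * (α + S)
        ≤ 2 * p₁ * (F * r) + 2 * q₁ * (G * v) - p₁ ^ 2 * r - q₁ ^ 2 * v
          - 2 * p₁ * q₁ * (α + S) ∧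
      F * G / 8 ≤ 2 * p₁ * q₁ + F ^ 2 / 4 * a + G ^ 2 / 4 * b by
    obtain ⟨p₁, q₁, hp₁, hq₁, hopt, hgain⟩ := hmain
    have key := h p₁ q₁ P Q hp₁ hq₁ hP0 hQ0
    have g1 : F * G / 8 ≤ 2 * p₁ * q₁ + P ^ 2 * a + Q ^ 2 * b := by
      have := mul_le_mul_of_nonneg_right hPP ha0.le
      have := mul_le_mul_of_nonneg_right hQQ hb0.le
      linarith
    have g2 := mul_le_mul_of_nonneg_left g1 hα
    simp only [bellmanLin] at key ⊢
    linarith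
  -- If `a` or `b` is large, the gain comes from `P` or `Q` and `p`, `q` are kept. Otherwise `a * b
  -- < 1 / 4`, so `T ≤ ℓ` is small against `√(r v)` and the gain comes from `p₁ * q₁`.
  by_cases c1 : G / 2 ≤ F * a
  · refine ⟨p, q, hp, hq, le_rfl, ?_⟩
    have := mul_le_mul_of_nonneg_left c1 hF
    have h1 : 0 ≤ p * q := by positivity
    have h2 : 0 ≤ G ^ 2 / 4 * b := by positivity
    have h3 : 0 ≤ F * G := by positivity
    linarith
  by_cases c2 : F / 2 ≤ G * b
  · refine ⟨p, q, hp, hq, le_rfl, ?_⟩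
    have := mul_le_mul_of_nonneg_left c2 hG
    have h1 : 0 ≤ p * q := by positivity
    have h2 : 0 ≤ F ^ 2 / 4 * a := by positivity
    have h3 : 0 ≤ F * G := by positivity
    linarith
  push Not at c1 c2
  set T := α + S with hT
  have hT0 : 0 ≤ T := by positivity
  have hFpos : 0 < F := by linarith [mul_nonneg hG hb0.le]
  have hGpos : 0 < G := by linarith [mul_nonneg hF ha0.le]
  have hab : a * b < 1 / 4 := by
    have h1 : (F * a) * (G * b) < (G / 2) * (F / 2) :=
      mul_lt_mul'' c1 c2 (by positivity) (by positivity)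
    have h2 : 0 < F * G := by positivity
    by_contra hcon
    push Not at hcon
    have := mul_le_mul_of_nonneg_right hcon h2.le
    linarith
  have hℓ2 : ℓ ^ 2 = a * b * (r * v) := by
    rw [show a * b * (r * v) = (a * v) * (b * r) by ring, hav, hbr]; ring
  have hT2 : T ^ 2 ≤ ℓ ^ 2 := by gcongr
  have hrv : 0 < r * v := by positivity
  have hdet : 0 < r * v - T ^ 2 := by
    have := mul_lt_mul_of_pos_right hab hrv
    linarith
  have hGT : G * T ≤ F / 2 * r := by
    calc G * T ≤ G * (b * r) := by rw [hbr]; gcongr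
      _ = (G * b) * r := by ring
      _ ≤ _ := by gcongr
  have hFT : F * T ≤ G / 2 * v := by
    calc F * T ≤ F * (a * v) := by rw [hav]; gcongr
      _ = (F * a) * v := by ring
      _ ≤ _ := by gcongr
  -- Cramer's rule for the critical point `p₁ r + q₁ T = F r`, `q₁ v + p₁ T = G v` of the quadratic
  -- in `p`, `q`.
  have hp1 : F / 2 ≤ (F * r * v - G * v * T) / (r * v - T ^ 2) := by
    rw [le_div_iff₀ hdet]
    linarith [mul_le_mul_of_nonneg_right hGT hv.le, mul_nonneg hF (sq_nonneg T)]
  have hq1 : G / 2 ≤ (G * v * r - F * r * T) / (r * v - T ^ 2) := by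
    rw [le_div_iff₀ hdet]
    linarith [mul_le_mul_of_nonneg_right hFT hr.le, mul_nonneg hG (sq_nonneg T)]
  have eq1 : (F * r * v - G * v * T) / (r * v - T ^ 2) * r
      + (G * v * r - F * r * T) / (r * v - T ^ 2) * T = F * r := by
    rw [div_mul_eq_mul_div, div_mul_eq_mul_div, ← add_div, div_eq_iff hdet.ne']
    ring
  have eq2 : (G * v * r - F * r * T) / (r * v - T ^ 2) * v
      + (F * r * v - G * v * T) / (r * v - T ^ 2) * T = G * v := by
    rw [div_mul_eq_mul_div, div_mul_eq_mul_div, ← add_div, div_eq_iff hdet.ne']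
    ring
  generalize (F * r * v - G * v * T) / (r * v - T ^ 2) = p₁ at *
  generalize (G * v * r - F * r * T) / (r * v - T ^ 2) = q₁ at *
  refine ⟨p₁, q₁, by linarith, by linarith, ?_, ?_⟩
  · rw [← eq1, ← eq2]
    -- At the critical point the loss from using `(p, q)` is exactly this quadratic form, which is
    -- positive because `T ^ 2 < r v`.
    have hpsd : 0 ≤ r * (p₁ - p) ^ 2 + v * (q₁ - q) ^ 2 + 2 * T * ((p₁ - p) * (q₁ - q)) := by
      have h1 : r * (r * (p₁ - p) ^ 2 + v * (q₁ - q) ^ 2 + 2 * T * ((p₁ - p) * (q₁ - q)))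
          = (r * (p₁ - p) + T * (q₁ - q)) ^ 2 + (r * v - T ^ 2) * (q₁ - q) ^ 2 := by ring
      have h2 : 0 ≤ r * (r * (p₁ - p) ^ 2 + v * (q₁ - q) ^ 2
          + 2 * T * ((p₁ - p) * (q₁ - q))) := by
        rw [h1]; positivity
      exact nonneg_of_mul_nonneg_right h2 hr
    linarith
  · have h1 : F / 2 * (G / 2) ≤ p₁ * q₁ := by gcongr; linarith
    have h2 : 0 ≤ F ^ 2 / 4 * a := by positivity
    have h3 : 0 ≤ G ^ 2 / 4 * b := by positivity
    have h4 : 0 ≤ F * G := by positivity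
    linarith

/-! ### Bilinear embedding for finite laminar families -/

/-- The Bellman induction over a finite family of sets any two of which are nested or disjoint. -/
theorem laminar_bellman {Ω ι : Type*} [MeasurableSpace Ω] {μ : Measure Ω} {w v f g : Ω → ℝ}
    (hf : ∀ x, 0 ≤ f x) (hg : ∀ x, 0 ≤ g x) (hw : ∀ᵐ x ∂μ, 0 ≤ w x) (hv : ∀ᵐ x ∂μ, 0 ≤ v x)
    {E : ι → Set Ω} {α ℓ : ι → ℝ} (s : Finset ι) :
    ∀ K : Set Ω, MeasurableSet K →
    IntegrableOn w K μ → IntegrableOn v K μ →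
    IntegrableOn (fun x => f x * w x) K μ → IntegrableOn (fun x => g x * v x) K μ →
    IntegrableOn (fun x => f x ^ 2 * w x) K μ → IntegrableOn (fun x => g x ^ 2 * v x) K μ →
    (∀ i ∈ s, MeasurableSet (E i)) → (∀ i ∈ s, E i ⊆ K) →
    (∀ i ∈ s, ∀ j ∈ s, E i ⊆ E j ∨ E j ⊆ E i ∨ Disjoint (E i) (E j)) →
    (∀ i ∈ s, 0 < ∫ x in E i, w x ∂μ) → (∀ i ∈ s, 0 < ∫ x in E i, v x ∂μ) →
    (∀ i ∈ s, 0 < ℓ i) → (∀ i ∈ s, 0 ≤ α i) →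
    (∀ i ∈ s, ∀ t ⊆ s, (∀ k ∈ t, E k ⊆ E i) → ∑ k ∈ t, α k ≤ ℓ i) →
    (∀ i ∈ s, ∀ t ⊆ s, (∀ k ∈ t, E k ⊆ E i) →
      ∑ k ∈ t, α k * ℓ k / ∫ x in E k, v x ∂μ ≤ ∫ x in E i, w x ∂μ) →
    (∀ i ∈ s, ∀ t ⊆ s, (∀ k ∈ t, E k ⊆ E i) →
      ∑ k ∈ t, α k * ℓ k / ∫ x in E k, w x ∂μ ≤ ∫ x in E i, v x ∂μ) →
    ∀ p q p' q' : ℝ, 0 ≤ p → 0 ≤ q → 0 ≤ p' → 0 ≤ q' →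
    bellmanLin (∫ x in K, f x * w x ∂μ) (∫ x in K, g x * v x ∂μ) (∫ x in K, w x ∂μ)
        (∫ x in K, v x ∂μ) (∑ k ∈ s, α k) (∑ k ∈ s, α k * ℓ k / ∫ x in E k, v x ∂μ)
        (∑ k ∈ s, α k * ℓ k / ∫ x in E k, w x ∂μ) p q p' q'
      + (∑ k ∈ s, α k * ((∫ x in E k, f x * w x ∂μ) / ∫ x in E k, w x ∂μ)
          * ((∫ x in E k, g x * v x ∂μ) / ∫ x in E k, v x ∂μ)) / 8
      ≤ 2 * (∫ x in K, f x ^ 2 * w x ∂μ) + 2 * ∫ x in K, g x ^ 2 * v x ∂μ := by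
  classical
  induction s using Finset.strongInduction with
  | H s ih =>
  intro K hK iw iv ifw igv iffw iggv hmeas hsub hlam hwE hvE hℓ hα H1 H2 H3 p q p' q' hp hq hp' hq'
  rcases s.eq_empty_or_nonempty with rfl | hne
  -- Integrate `(f - t) ^ 2 * w ≥ 0`. Each of `f`, `g` is used with two parameters, whence the
  -- factors 2 on the right-hand side.
  · have aux : ∀ {f w : Ω → ℝ} (t : ℝ), (∀ᵐ x ∂μ, 0 ≤ w x) → IntegrableOn w K μ →
        IntegrableOn (fun x => f x * w x) K μ → IntegrableOn (fun x => f x ^ 2 * w x) K μ →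
        2 * t * (∫ x in K, f x * w x ∂μ) - t ^ 2 * (∫ x in K, w x ∂μ)
          ≤ ∫ x in K, f x ^ 2 * w x ∂μ := by
      intro f w t hw h1 h2 h3
      rw [← integral_const_mul, ← integral_const_mul,
        ← integral_sub (h2.const_mul _) (h1.const_mul _)]
      refine integral_mono_ae ((h2.const_mul _).sub (h1.const_mul _)) h3 ?_
      filter_upwards [ae_restrict_of_ae hw] with x hx
      nlinarith [mul_nonneg hx (sq_nonneg (f x - t))]
    have a1 := aux p hw iw ifw iffw
    have a2 := aux p' hw iw ifw iffw
    have a3 := aux q hv iv igv iggv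
    have a4 := aux q' hv iv igv iggv
    simp only [bellmanLin, Finset.sum_empty]
    linarith
  -- Sets may repeat in the family, so `E i` is maximal only up to equality. Members other than `i`
  -- lie inside `E i` (copies of it included) or are disjoint from it. The Carleson hypotheses range
  -- over all subfamilies `t`, so they pass to both parts.
  obtain ⟨i, hi, hmax⟩ : ∃ i ∈ s, ∀ j ∈ s, E i ⊆ E j → E j ⊆ E i := by
    obtain ⟨i, hi⟩ := s.exists_maximalFor E hne
    exact ⟨i, hi.1, fun j hj hij => hi.2 hj hij⟩
  set s₁ := (s.filter (fun k => E k ⊆ E i)).erase i with hs₁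
  set s₂ := s.filter (fun k => ¬ E k ⊆ E i) with hs₂
  have his₁ : i ∉ s₁ := by simp [hs₁]
  have hins : insert i s₁ = s.filter (fun k => E k ⊆ E i) :=
    Finset.insert_erase (by simp [hi])
  have s₁s : s₁ ⊆ s := (Finset.erase_subset _ _).trans (Finset.filter_subset _ _)
  have s₂s : s₂ ⊆ s := Finset.filter_subset _ _
  have hss₁ : s₁ ⊂ s := ⟨s₁s, fun h => his₁ (h hi)⟩
  have hss₂ : s₂ ⊂ s := ⟨s₂s, fun h => by simpa [hs₂] using h hi⟩
  have s₁i : ∀ k ∈ s₁, E k ⊆ E i := fun k hk => by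
    have := Finset.mem_of_mem_erase hk
    exact (Finset.mem_filter.1 this).2
  have s₂i : ∀ k ∈ s₂, E k ⊆ K \ E i := fun k hk => by
    obtain ⟨hks, hki⟩ := Finset.mem_filter.1 hk
    rcases hlam k hks i hi with h | h | h
    · exact absurd h hki
    · exact absurd (hmax k hks h) hki
    · exact Set.subset_sdiff.2 ⟨hsub k hks, h⟩
  have hiK := hsub i hi
  have hmi := hmeas i hi
  have split : ∀ F : ι → ℝ, ∑ k ∈ s, F k = F i + ∑ k ∈ s₁, F k + ∑ k ∈ s₂, F k := fun F => by
    rw [← Finset.sum_insert his₁, hins, hs₂, Finset.sum_filter_add_sum_filter_not]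
  have isplit : ∀ {F : Ω → ℝ}, IntegrableOn F K μ →
      ∫ x in K, F x ∂μ = ∫ x in E i, F x ∂μ + ∫ x in K \ E i, F x ∂μ := fun {F} hF => by
    rw [add_comm, setIntegral_sdiff hmi hF hiK]; ring
  have I2 := ih s₂ hss₂ (K \ E i) (hK.diff hmi) (iw.mono_set Set.sdiff_subset)
    (iv.mono_set Set.sdiff_subset) (ifw.mono_set Set.sdiff_subset) (igv.mono_set Set.sdiff_subset)
    (iffw.mono_set Set.sdiff_subset) (iggv.mono_set Set.sdiff_subset)
    (fun k hk => hmeas k (s₂s hk)) s₂i (fun k hk l hl => hlam k (s₂s hk) l (s₂s hl))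
    (fun k hk => hwE k (s₂s hk)) (fun k hk => hvE k (s₂s hk)) (fun k hk => hℓ k (s₂s hk))
    (fun k hk => hα k (s₂s hk)) (fun k hk t ht => H1 k (s₂s hk) t (ht.trans s₂s))
    (fun k hk t ht => H2 k (s₂s hk) t (ht.trans s₂s))
    (fun k hk t ht => H3 k (s₂s hk) t (ht.trans s₂s)) p q p' q' hp hq hp' hq'
  have I1 := ih s₁ hss₁ (E i) hmi (iw.mono_set hiK)
    (iv.mono_set hiK) (ifw.mono_set hiK) (igv.mono_set hiK)
    (iffw.mono_set hiK) (iggv.mono_set hiK)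
    (fun k hk => hmeas k (s₁s hk)) s₁i (fun k hk l hl => hlam k (s₁s hk) l (s₁s hl))
    (fun k hk => hwE k (s₁s hk)) (fun k hk => hvE k (s₁s hk)) (fun k hk => hℓ k (s₁s hk))
    (fun k hk => hα k (s₁s hk)) (fun k hk t ht => H1 k (s₁s hk) t (ht.trans s₁s))
    (fun k hk t ht => H2 k (s₁s hk) t (ht.trans s₁s))
    (fun k hk t ht => H3 k (s₁s hk) t (ht.trans s₁s))
  have hinssub : insert i s₁ ⊆ s := Finset.insert_subset hi s₁s
  have hinsi : ∀ k ∈ insert i s₁, E k ⊆ E i := fun k hk => by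
    rcases Finset.mem_insert.1 hk with rfl | hk
    · exact subset_rfl
    · exact s₁i k hk
  have C1 := H1 i hi _ hinssub hinsi
  have C2 := H2 i hi _ hinssub hinsi
  have C3 := H3 i hi _ hinssub hinsi
  rw [Finset.sum_insert his₁] at C1 C2 C3
  have hr := hwE i hi
  have hv' := hvE i hi
  have pos : ∀ {r : ι → ℝ}, (∀ k ∈ s, 0 < r k) → 0 ≤ ∑ k ∈ s₁, α k * ℓ k / r k := fun hr =>
    Finset.sum_nonneg fun k hk => div_nonneg (mul_nonneg (hα k (s₁s hk)) (hℓ k (s₁s hk)).le)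
      (hr k (s₁s hk)).le
  have inonneg : ∀ {f w : Ω → ℝ}, (∀ x, 0 ≤ f x) → (∀ᵐ x ∂μ, 0 ≤ w x) →
      0 ≤ ∫ x in E i, f x * w x ∂μ := fun {f w} hf hw => by
    refine integral_nonneg_of_ae ?_
    filter_upwards [ae_restrict_of_ae hw] with x hx using mul_nonneg (hf x) hx
  have hxF : (∫ x in E i, f x * w x ∂μ) =
      (∫ x in E i, f x * w x ∂μ) / (∫ x in E i, w x ∂μ) * ∫ x in E i, w x ∂μ := by
    field_simp
  have hyG : (∫ x in E i, g x * v x ∂μ) =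
      (∫ x in E i, g x * v x ∂μ) / (∫ x in E i, v x ∂μ) * ∫ x in E i, v x ∂μ := by
    field_simp
  -- The sum already gained strictly below `i` is moved into `D`. The induction hypothesis on `E i`
  -- supplies the pre-jump bound for every choice of parameters, as the jump requires.
  have J := bellmanLin_jump (α := α i) (ℓ := ℓ i) (p := p) (q := q) (p' := p') (q' := q')
    (S := ∑ k ∈ s₁, α k) (N := ∑ k ∈ s₁, α k * ℓ k / ∫ x in E k, v x ∂μ)
    (M := ∑ k ∈ s₁, α k * ℓ k / ∫ x in E k, w x ∂μ)
    (D := 2 * (∫ x in E i, f x ^ 2 * w x ∂μ) + 2 * (∫ x in E i, g x ^ 2 * v x ∂μ)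
      - (∑ k ∈ s₁, α k * ((∫ x in E k, f x * w x ∂μ) / ∫ x in E k, w x ∂μ)
          * ((∫ x in E k, g x * v x ∂μ) / ∫ x in E k, v x ∂μ)) / 8)
    (div_nonneg (inonneg hf hw) hr.le) (div_nonneg (inonneg hg hv) hv'.le) hr hv' (hℓ i hi)
    (hα i hi) (Finset.sum_nonneg fun k hk => hα k (s₁s hk)) (pos hvE) (pos hwE) C1 C2 C3
    (fun p q p' q' hp hq hp' hq' => by
      rw [← hxF, ← hyG]
      linarith [I1 p q p' q' hp hq hp' hq']) hp hq
  rw [← hxF, ← hyG] at J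
  -- For fixed parameters everything is additive, so `J` on `E i` and `I2` on `K \ E i` add up to
  -- the claim.
  simp only [split]
  rw [isplit iw, isplit iv, isplit ifw, isplit igv, isplit iffw, isplit iggv]
  simp only [bellmanLin] at I2 J ⊢
  linarith

/-- The bilinear embedding for a finite family of sets any two of which are nested or disjoint. -/
theorem laminar_bilinear_embedding {Ω ι : Type*} [MeasurableSpace Ω] {μ : Measure Ω}
    {w v f g : Ω → ℝ}
    (hf : ∀ x, 0 ≤ f x) (hg : ∀ x, 0 ≤ g x) (hw : ∀ᵐ x ∂μ, 0 ≤ w x) (hv : ∀ᵐ x ∂μ, 0 ≤ v x)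
    {E : ι → Set Ω} {α ℓ : ι → ℝ} {A : ℝ} (hA : 0 < A) (s : Finset ι)
    {K : Set Ω} (hK : MeasurableSet K)
    (iw : IntegrableOn w K μ) (iv : IntegrableOn v K μ)
    (ifw : IntegrableOn (fun x => f x * w x) K μ) (igv : IntegrableOn (fun x => g x * v x) K μ)
    (iffw : IntegrableOn (fun x => f x ^ 2 * w x) K μ)
    (iggv : IntegrableOn (fun x => g x ^ 2 * v x) K μ)
    (hmeas : ∀ i ∈ s, MeasurableSet (E i)) (hsub : ∀ i ∈ s, E i ⊆ K)
    (hlam : ∀ i ∈ s, ∀ j ∈ s, E i ⊆ E j ∨ E j ⊆ E i ∨ Disjoint (E i) (E j))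
    (hwE : ∀ i ∈ s, 0 < ∫ x in E i, w x ∂μ) (hvE : ∀ i ∈ s, 0 < ∫ x in E i, v x ∂μ)
    (hℓ : ∀ i ∈ s, 0 < ℓ i) (hα : ∀ i ∈ s, 0 ≤ α i)
    (H1 : ∀ i ∈ s, ∀ t ⊆ s, (∀ k ∈ t, E k ⊆ E i) → ∑ k ∈ t, α k ≤ A * ℓ i)
    (H2 : ∀ i ∈ s, ∀ t ⊆ s, (∀ k ∈ t, E k ⊆ E i) →
      ∑ k ∈ t, α k * ℓ k / ∫ x in E k, v x ∂μ ≤ A * ∫ x in E i, w x ∂μ)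
    (H3 : ∀ i ∈ s, ∀ t ⊆ s, (∀ k ∈ t, E k ⊆ E i) →
      ∑ k ∈ t, α k * ℓ k / ∫ x in E k, w x ∂μ ≤ A * ∫ x in E i, v x ∂μ) :
    ∑ k ∈ s, α k * ((∫ x in E k, f x * w x ∂μ) / ∫ x in E k, w x ∂μ)
          * ((∫ x in E k, g x * v x ∂μ) / ∫ x in E k, v x ∂μ)
      ≤ 32 * A * √(∫ x in K, f x ^ 2 * w x ∂μ) * √(∫ x in K, g x ^ 2 * v x ∂μ) := by
  set Z := ∑ k ∈ s, α k * ((∫ x in E k, f x * w x ∂μ) / ∫ x in E k, w x ∂μ)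
          * ((∫ x in E k, g x * v x ∂μ) / ∫ x in E k, v x ∂μ) with hZ
  set X := ∫ x in K, f x ^ 2 * w x ∂μ with hX
  set Y := ∫ x in K, g x ^ 2 * v x ∂μ with hY
  have inonneg : ∀ {f w : Ω → ℝ} (L : Set Ω), (∀ x, 0 ≤ f x) → (∀ᵐ x ∂μ, 0 ≤ w x) →
      0 ≤ ∫ x in L, f x * w x ∂μ := fun {f w} L hf hw => by
    refine integral_nonneg_of_ae ?_
    filter_upwards [ae_restrict_of_ae hw] with x hx using mul_nonneg (hf x) hx
  have hX0 : 0 ≤ X := inonneg K (fun x => sq_nonneg (f x)) hw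
  have hY0 : 0 ≤ Y := inonneg K (fun x => sq_nonneg (g x)) hv
  have hZ0 : 0 ≤ Z := Finset.sum_nonneg fun k hk =>
    mul_nonneg (mul_nonneg (hα k hk) (div_nonneg (inonneg _ hf hw) (hwE k hk).le))
      (div_nonneg (inonneg _ hg hv) (hvE k hk).le)
  have scaled : ∀ t : ℝ, 0 ≤ t → t * (Z / A) ≤ 16 * (t ^ 2 * X + Y) := by
    intro t ht
    have e1 : ∀ x, t * f x * w x = t * (f x * w x) := fun x => by ring
    have e2 : ∀ x, (t * f x) ^ 2 * w x = t ^ 2 * (f x ^ 2 * w x) := fun x => by ring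
    have sc : ∀ (t : Finset ι) (β : ι → ℝ) (c : ℝ), ∑ k ∈ t, α k * ℓ k / β k ≤ A * c →
        ∑ k ∈ t, α k / A * ℓ k / β k ≤ c := fun t β c h => by
      have : ∑ k ∈ t, α k / A * ℓ k / β k = (∑ k ∈ t, α k * ℓ k / β k) / A := by
        rw [Finset.sum_div]
        exact Finset.sum_congr rfl fun k _ => by ring
      rw [this, div_le_iff₀ hA]
      linarith
    -- Dividing `α` by `A` normalises the Carleson constant to 1. At zero parameters `bellmanLin`
    -- vanishes, leaving one eighth of the sum against twice the norms: hence 16.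
    have := laminar_bellman (f := fun x => t * f x) (α := fun k => α k / A) (E := E) (ℓ := ℓ)
      (fun x => mul_nonneg ht (hf x)) hg hw hv s K hK iw iv
      (by simp only [e1]; exact ifw.const_mul t) igv
      (by simp only [e2]; exact iffw.const_mul _) iggv hmeas hsub hlam hwE hvE hℓ
      (fun k hk => div_nonneg (hα k hk) hA.le)
      (fun i hi t ht h => by
        rw [← Finset.sum_div, div_le_iff₀ hA]
        linarith [H1 i hi t ht h])
      (fun i hi t ht h => sc _ _ _ (H2 i hi t ht h))
      (fun i hi t ht h => sc _ _ _ (H3 i hi t ht h)) 0 0 0 0 le_rfl le_rfl le_rfl le_rfl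
    simp only [e1, e2, integral_const_mul, bellmanLin] at this
    have hsum : ∑ k ∈ s, α k / A * ((t * ∫ x in E k, f x * w x ∂μ) / ∫ x in E k, w x ∂μ)
          * ((∫ x in E k, g x * v x ∂μ) / ∫ x in E k, v x ∂μ) = t * (Z / A) := by
      rw [hZ, Finset.sum_div, Finset.mul_sum]
      exact Finset.sum_congr rfl fun k _ => by ring
    rw [hsum] at this
    linarith
  have hZA : 0 ≤ Z / A := div_nonneg hZ0 hA.le
  -- The quadratic `16 X t² - (Z / A) t + 16 Y` is nonnegative for every real `t`, so `(Z / A)² ≤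
  -- 32² X Y`.
  have hdisc : discrim (16 * X) (-(Z / A)) (16 * Y) ≤ 0 := by
    refine discrim_le_zero fun t => ?_
    rcases le_total 0 t with ht | ht
    · nlinarith [scaled t ht]
    · nlinarith [mul_nonneg hX0 (mul_self_nonneg t), mul_nonneg (neg_nonneg.2 ht) hZA]
  have hsq : (Z / A) ^ 2 ≤ (32 * (√X * √Y)) ^ 2 := by
    rw [mul_pow, mul_pow, Real.sq_sqrt hX0, Real.sq_sqrt hY0]
    rw [discrim] at hdisc
    nlinarith
  have := abs_le_of_sq_le_sq hsq (by positivity)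
  have := (div_le_iff₀ hA).1 ((le_abs_self _).trans this)
  linarith

/-! ### Dyadic intervals and boxes -/

theorem mem_dyadicInterval_iff {k m : ℤ} {x : ℝ} :
    x ∈ dyadicInterval k m ↔ (m : ℝ) ≤ x * 2 ^ k ∧ x * 2 ^ k < m + 1 := by
  have h : (0 : ℝ) < 2 ^ k := by positivity
  rw [dyadicInterval, Set.mem_Ico, zpow_neg, ← div_eq_mul_inv, ← div_eq_mul_inv, div_le_iff₀ h,
    lt_div_iff₀ h]

theorem dyadicInterval_nonempty (k m : ℤ) : (dyadicInterval k m).Nonempty :=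
  Set.nonempty_Ico.2 (mul_lt_mul_of_pos_right (by linarith) (by positivity))

theorem measurableSet_dyadicInterval (k m : ℤ) : MeasurableSet (dyadicInterval k m) :=
  measurableSet_Ico

theorem dyadicInterval_subset_or_disjoint {k l : ℤ} (hkl : k ≤ l) (m c : ℤ) :
    dyadicInterval l c ⊆ dyadicInterval k m ∨ Disjoint (dyadicInterval l c) (dyadicInterval k m) := by
  rw [or_iff_not_imp_right, Set.not_disjoint_iff]
  rintro ⟨x, hxl, hxk⟩ y hyl
  obtain ⟨d, rfl⟩ := Int.exists_add_of_le hkl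
  rw [mem_dyadicInterval_iff] at *
  have hz : ∀ z : ℝ, z * 2 ^ (k + (d : ℤ)) = z * 2 ^ k * ((2 ^ d : ℤ) : ℝ) := fun z => by
    rw [zpow_add₀ two_ne_zero]; push_cast [zpow_natCast]; ring
  rw [hz] at hxl hyl
  have hd : (0 : ℝ) < ((2 ^ d : ℤ) : ℝ) := by positivity
  have h1 : m * 2 ^ d < c + 1 := by
    have : ((m * 2 ^ d : ℤ) : ℝ) < ((c + 1 : ℤ) : ℝ) := by
      rw [Int.cast_mul, Int.cast_add, Int.cast_one]
      exact lt_of_le_of_lt (mul_le_mul_of_nonneg_right hxk.1 hd.le) hxl.2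
    exact_mod_cast this
  have h2 : c < (m + 1) * 2 ^ d := by
    have : ((c : ℤ) : ℝ) < (((m + 1) * 2 ^ d : ℤ) : ℝ) := by
      rw [Int.cast_mul, Int.cast_add, Int.cast_one]
      exact lt_of_le_of_lt hxl.1 (mul_lt_mul_of_pos_right hxk.2 hd)
    exact_mod_cast this
  -- Endpoints are integers on the finer grid, so a strict inequality improves by one.
  have h1' : ((m * 2 ^ d : ℤ) : ℝ) ≤ (c : ℝ) := by exact_mod_cast Int.lt_add_one_iff.1 h1
  have h2' : (c : ℝ) + 1 ≤ (((m + 1) * 2 ^ d : ℤ) : ℝ) := by exact_mod_cast h2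
  rw [Int.cast_mul] at h1' h2'
  constructor
  · exact le_of_mul_le_mul_right (h1'.trans hyl.1) hd
  · have := lt_of_mul_lt_mul_right (hyl.2.trans_le h2') hd.le
    push_cast at this
    exact this

theorem le_of_dyadicInterval_subset {k l m c : ℤ}
    (h : dyadicInterval l c ⊆ dyadicInterval k m) : k ≤ l := by
  have hv : volume (dyadicInterval l c) ≤ volume (dyadicInterval k m) := measure_mono h
  simp only [dyadicInterval, Real.volume_Ico] at hv
  rw [← sub_mul, ← sub_mul, add_sub_cancel_left, add_sub_cancel_left, one_mul, one_mul,
    ENNReal.ofReal_le_ofReal_iff (by positivity),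
    zpow_le_zpow_iff_right₀ (by norm_num)] at hv
  omega

theorem dyadicInterval_halves (k m : ℤ) :
    dyadicInterval (k + 1) (2 * m) ∪ dyadicInterval (k + 1) (2 * m + 1) = dyadicInterval k m := by
  ext x
  rw [Set.mem_union, mem_dyadicInterval_iff, mem_dyadicInterval_iff, mem_dyadicInterval_iff,
    zpow_add_one₀ two_ne_zero]
  push_cast
  constructor
  · rintro (⟨h1, h2⟩ | ⟨h1, h2⟩) <;> constructor <;> linarith
  · rintro ⟨h1, h2⟩
    rcases lt_or_ge (x * (2 ^ k * 2)) (2 * m + 1) with h | h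
    · exact Or.inl ⟨by linarith, h⟩
    · exact Or.inr ⟨h, by linarith⟩

/-- The box with sides `dyadicInterval (κ i) (c i)`. -/
def dyadicBox {n : ℕ} (κ c : Fin n → ℤ) : Set (Fin n → ℝ) :=
  {x | ∀ i, x i ∈ dyadicInterval (κ i) (c i)}

theorem dyadicBox_eq_pi {n : ℕ} (κ c : Fin n → ℤ) :
    dyadicBox κ c = Set.pi Set.univ fun i => dyadicInterval (κ i) (c i) := by
  ext x; simp [dyadicBox]

theorem dyadicBox_nonempty {n : ℕ} (κ c : Fin n → ℤ) : (dyadicBox κ c).Nonempty := by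
  rw [dyadicBox_eq_pi]
  exact Set.univ_pi_nonempty_iff.2 fun i => dyadicInterval_nonempty _ _

theorem measurableSet_dyadicBox {n : ℕ} (κ c : Fin n → ℤ) : MeasurableSet (dyadicBox κ c) := by
  rw [dyadicBox_eq_pi]
  exact MeasurableSet.univ_pi fun i => measurableSet_dyadicInterval _ _

theorem volume_dyadicBox_pos {n : ℕ} (κ c : Fin n → ℤ) : 0 < volume (dyadicBox κ c) := by
  rw [dyadicBox_eq_pi, volume_pi_pi]
  refine pos_iff_ne_zero.2 (Finset.prod_ne_zero_iff.2 fun i _ => ?_)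
  rw [dyadicInterval, Real.volume_Ico, ← sub_mul, add_sub_cancel_left, one_mul]
  exact (ENNReal.ofReal_pos.2 (by positivity)).ne'

theorem volume_dyadicBox_lt_top {n : ℕ} (κ c : Fin n → ℤ) : volume (dyadicBox κ c) < ∞ := by
  rw [dyadicBox_eq_pi, volume_pi_pi]
  exact ENNReal.prod_lt_top fun i _ => measure_Ico_lt_top

theorem dyadicBox_subset_isCompact {n : ℕ} (κ c : Fin n → ℤ) :
    ∃ L, IsCompact L ∧ dyadicBox κ c ⊆ L := by
  rw [dyadicBox_eq_pi]
  exact ⟨_, isCompact_univ_pi fun i => isCompact_Icc,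
    Set.pi_mono fun i _ => Set.Ico_subset_Icc_self⟩

theorem dyadicBox_subset_or_disjoint {n : ℕ} {κ κ' : Fin n → ℤ} (h : κ ≤ κ') (c c' : Fin n → ℤ) :
    dyadicBox κ' c' ⊆ dyadicBox κ c ∨ Disjoint (dyadicBox κ' c') (dyadicBox κ c) := by
  by_cases hd : ∃ i, Disjoint (dyadicInterval (κ' i) (c' i)) (dyadicInterval (κ i) (c i))
  · obtain ⟨i, hi⟩ := hd
    exact Or.inr (Set.disjoint_left.2 fun x hx hx' => Set.disjoint_left.1 hi (hx i) (hx' i))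
  · push Not at hd
    refine Or.inl fun x hx i => ?_
    exact (dyadicInterval_subset_or_disjoint (h i) _ _).resolve_right (hd i) (hx i)

theorem DyadicCube.carrier_eq_dyadicBox {n : ℕ} (Q : DyadicCube n) :
    Q.carrier = dyadicBox (fun _ => Q.k) Q.m := rfl

/-! ### Geometry of the Wilson sets -/

/-- The scales of the Wilson sets: the first `t` sides are sides of the cube, the others are halves
of sides. -/
def wilsonScale (n : ℕ) (k : ℤ) (t : ℕ) (i : Fin n) : ℤ := if (i : ℕ) < t then k else k + 1

/-- Halving always affects a final segment of coordinates, so for one cube size the scales are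
ordered by `t`; between different sizes a full halving dominates. This comparability is what makes
the Wilson sets laminar. -/
theorem wilsonScale_total {n : ℕ} (k k' : ℤ) (t t' : ℕ) :
    wilsonScale n k t ≤ wilsonScale n k' t' ∨ wilsonScale n k' t' ≤ wilsonScale n k t := by
  rcases lt_trichotomy k k' with h | rfl | h
  · left; intro i; simp only [wilsonScale]; split_ifs <;> omega
  · rcases le_total t t' with h | h
    · right; intro i; simp only [wilsonScale]; split_ifs <;> omega
    · left; intro i; simp only [wilsonScale]; split_ifs <;> omega
  · right; intro i; simp only [wilsonScale]; split_ifs <;> omega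

theorem wilsonSet_one {n : ℕ} (Q : DyadicCube (n + 1)) : wilsonSet Q 1 = Q.carrier := by
  ext x
  have h := Set.ext_iff.1 (dyadicInterval_halves Q.k (Q.m (Fin.last n))) (x (Fin.last n))
  simp only [Set.mem_union] at h
  simp [wilsonSet, wilsonHalf, DyadicCube.carrier, DyadicCube.base, DyadicCube.lastHalf,
    Fin.forall_fin_succ', ← and_or_left, h]

theorem wilsonSet_succ {n : ℕ} (Q : DyadicCube (n + 1)) {j : ℕ} (hj : j ≠ 1) :
    wilsonSet Q j = {x | (fun i : Fin n => x i.castSucc) ∈ wilsonSet Q.base (j / 2) ∧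
      x (Fin.last n) ∈ Q.lastHalf (j % 2)} := by
  ext x
  simp [wilsonSet, wilsonHalf, hj, or_and_right]

/-- The recursion halves the last edge, then passes to the base until it meets a pair whose union is
a full cube. The condition `0 < t` records that the first edge is never halved. -/
theorem exists_wilsonSet_eq_dyadicBox {n : ℕ} (Q : DyadicCube n) {j : ℕ}
    (hj : j ∈ Finset.Icc 1 (2 ^ n - 1)) :
    ∃ (t : ℕ) (c : Fin n → ℤ), 0 < t ∧ wilsonSet Q j = dyadicBox (wilsonScale n Q.k t) c ∧
      wilsonSet Q j ⊆ Q.carrier := by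
  induction n generalizing j with
  | zero => simp at hj
  | succ n ih =>
    rw [Finset.mem_Icc] at hj
    by_cases h1 : j = 1
    · subst h1
      refine ⟨n + 1, Q.m, n.succ_pos, ?_, (wilsonSet_one Q).subset⟩
      rw [wilsonSet_one, DyadicCube.carrier_eq_dyadicBox]
      congr 1
      ext i
      simp [wilsonScale, Nat.lt_succ_iff.1 i.2]
    · have hpow : 2 ^ (n + 1) = 2 * 2 ^ n := pow_succ' 2 n
      obtain ⟨t, c, ht, hE, hsub⟩ := ih Q.base (j := j / 2) (Finset.mem_Icc.2 (by omega))
      -- Capping at `n` ensures that the new last edge counts as halved.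
      refine ⟨min t n, Fin.snoc c (2 * Q.m (Fin.last n) + ((j % 2 : ℕ) : ℤ)), ?_, ?_, ?_⟩
      · rcases n with _ | n
        · simp at hj; omega
        · omega
      · rw [wilsonSet_succ Q h1, hE]
        ext x
        simp [dyadicBox, wilsonScale, DyadicCube.lastHalf, DyadicCube.base, Fin.forall_fin_succ']
      · rw [wilsonSet_succ Q h1]
        rintro x ⟨hx, hx'⟩
        have hb := hsub hx
        refine Fin.forall_fin_succ'.2 ⟨hb, ?_⟩
        have hh := dyadicInterval_halves Q.k (Q.m (Fin.last n))
        rw [DyadicCube.lastHalf] at hx'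
        rcases Nat.mod_two_eq_zero_or_one j with h | h
        · rw [h] at hx'
          exact hh.subset (Or.inl (by simpa using hx'))
        · rw [h] at hx'
          exact hh.subset (Or.inr (by simpa using hx'))

theorem wilsonSet_subset_carrier {n : ℕ} (Q : DyadicCube n) {j : ℕ}
    (hj : j ∈ Finset.Icc 1 (2 ^ n - 1)) : wilsonSet Q j ⊆ Q.carrier := by
  obtain ⟨_, _, _, _, h⟩ := exists_wilsonSet_eq_dyadicBox Q hj
  exact h

theorem wilsonSet_nested_or_disjoint {n : ℕ} (Q R : DyadicCube n) {j i : ℕ}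
    (hj : j ∈ Finset.Icc 1 (2 ^ n - 1)) (hi : i ∈ Finset.Icc 1 (2 ^ n - 1)) :
    wilsonSet Q j ⊆ wilsonSet R i ∨ wilsonSet R i ⊆ wilsonSet Q j ∨
      Disjoint (wilsonSet Q j) (wilsonSet R i) := by
  obtain ⟨t, c, _, hE, _⟩ := exists_wilsonSet_eq_dyadicBox Q hj
  obtain ⟨t', c', _, hE', _⟩ := exists_wilsonSet_eq_dyadicBox R hi
  rw [hE, hE']
  rcases wilsonScale_total (n := n) Q.k R.k t t' with h | h
  · rcases dyadicBox_subset_or_disjoint h c c' with h | h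
    · exact Or.inr (Or.inl h)
    · exact Or.inr (Or.inr h.symm)
  · rcases dyadicBox_subset_or_disjoint h c' c with h | h
    · exact Or.inl h
    · exact Or.inr (Or.inr h)

/-- The first edge of a Wilson set is a full edge of its cube, so containment compares the sizes of
the cubes, and meeting dyadic cubes are nested. Hence restricting the Carleson sums to subcubes
loses no Wilson set contained in the given one. -/
theorem mem_subcubes_of_wilsonSet_subset {n : ℕ} {Q R : DyadicCube n} {j i : ℕ}
    (hj : j ∈ Finset.Icc 1 (2 ^ n - 1)) (hi : i ∈ Finset.Icc 1 (2 ^ n - 1))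
    (h : wilsonSet R j ⊆ wilsonSet Q i) : R ∈ Q.subcubes := by
  obtain ⟨t, c, ht, hE, hR⟩ := exists_wilsonSet_eq_dyadicBox R hj
  have hQ := h.trans (wilsonSet_subset_carrier Q hi)
  have hne : (wilsonSet R j).Nonempty := hE ▸ dyadicBox_nonempty _ _
  have hn : 0 < n := by
    rcases n with _ | n
    · simp at hj
    · omega
  have hk : Q.k ≤ R.k := by
    have h0 := hE ▸ hQ
    rw [DyadicCube.carrier_eq_dyadicBox, dyadicBox_eq_pi, dyadicBox_eq_pi,
      Set.pi_subset_pi_iff] at h0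
    rcases h0 with h0 | h0
    · have := h0 ⟨0, hn⟩ (Set.mem_univ _)
      simp only [wilsonScale, ht, if_true] at this
      exact le_of_dyadicInterval_subset this
    · exact absurd h0 (Set.univ_pi_nonempty_iff.2 fun i => dyadicInterval_nonempty _ _).ne_empty
  refine (dyadicBox_subset_or_disjoint (κ := fun _ => Q.k) (κ' := fun _ => R.k) (fun _ => hk)
    Q.m R.m).resolve_right fun hd => ?_
  obtain ⟨x, hx⟩ := hne
  exact Set.disjoint_left.1 hd (hR hx) (hQ hx)

/-! ### Integrals against a weight -/

namespace IsWeight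

variable {n : ℕ} {w f : (Fin n → ℝ) → ℝ}

theorem ae_nonneg (hw : IsWeight w) : ∀ᵐ x, 0 ≤ w x := hw.ae_pos.mono fun _ h => h.le

theorem integrableOn_dyadicBox (hw : IsWeight w) (κ c : Fin n → ℤ) :
    IntegrableOn w (dyadicBox κ c) := by
  obtain ⟨L, hL, hsub⟩ := dyadicBox_subset_isCompact κ c
  exact (hw.locallyIntegrable.integrableOn_isCompact hL).mono_set hsub

theorem setIntegral_dyadicBox_pos (hw : IsWeight w) (κ c : Fin n → ℤ) :
    0 < ∫ x in dyadicBox κ c, w x := by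
  rw [setIntegral_pos_iff_support_of_nonneg_ae (ae_restrict_of_ae hw.ae_nonneg)
    (hw.integrableOn_dyadicBox κ c)]
  refine (volume_dyadicBox_pos κ c).trans_le (measure_mono_ae ?_)
  filter_upwards [hw.ae_pos] with x hx hxE
  exact ⟨hx.ne', hxE⟩

theorem aemeasurable_ofReal (hw : IsWeight w) : AEMeasurable (fun x => ENNReal.ofReal (w x)) :=
  hw.locallyIntegrable.aestronglyMeasurable.aemeasurable.ennreal_ofReal

theorem integrable_sq_mul (hw : IsWeight w) (hf : MemLp f 2 (weightMeasure w)) :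
    Integrable (fun x => f x ^ 2 * w x) := by
  have h := hf.integrable_sq
  rw [weightMeasure, integrable_withDensity_iff_integrable_smul₀' hw.aemeasurable_ofReal
    (ae_of_all _ fun x => ENNReal.ofReal_lt_top)] at h
  refine h.congr ?_
  filter_upwards [hw.ae_nonneg] with x hx
  rw [ENNReal.toReal_ofReal hx, smul_eq_mul, mul_comm]

theorem integral_sq_mul (hw : IsWeight w) (hf : MemLp f 2 (weightMeasure w)) :
    ∫ x, f x ^ 2 * w x = weightedL2Norm w f ^ 2 := by
  have h : ∫ x, f x ^ 2 ∂(weightMeasure w) = ∫ x, f x ^ 2 * w x := by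
    rw [weightMeasure, integral_withDensity_eq_integral_toReal_smul₀ hw.aemeasurable_ofReal
      (ae_of_all _ fun x => ENNReal.ofReal_lt_top)]
    refine integral_congr_ae ?_
    filter_upwards [hw.ae_nonneg] with x hx
    rw [ENNReal.toReal_ofReal hx, smul_eq_mul, mul_comm]
  have h0 : 0 ≤ ∫ x, f x ^ 2 ∂(weightMeasure w) := integral_nonneg fun x => sq_nonneg _
  rw [← h, weightedL2Norm, hf.eLpNorm_eq_integral_rpow_norm (by norm_num) (by norm_num)]
  simp only [ENNReal.toReal_ofNat, Real.norm_eq_abs, Real.rpow_ofNat, sq_abs]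
  rw [ENNReal.toReal_ofReal (by positivity), ← Real.rpow_natCast, ← Real.rpow_mul h0]
  norm_num

theorem integrableOn_mul (hw : IsWeight w) (hf : MemLp f 2 (weightMeasure w))
    (κ c : Fin n → ℤ) : IntegrableOn (fun x => f x * w x) (dyadicBox κ c) := by
  have hi := hw.integrableOn_dyadicBox κ c
  have hr : (weightMeasure w).restrict (dyadicBox κ c)
      = (volume.restrict (dyadicBox κ c)).withDensity fun x => ENNReal.ofReal (w x) :=
    restrict_withDensity (measurableSet_dyadicBox κ c) _
  -- A box has finite `w dx` measure, so square integrability there implies integrability.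
  have := isFiniteMeasure_withDensity_ofReal hi.hasFiniteIntegral
  have hf' := hf.restrict (dyadicBox κ c)
  rw [hr] at hf'
  have h := hf'.integrable (by norm_num)
  rw [integrable_withDensity_iff_integrable_smul₀' hw.aemeasurable_ofReal.restrict
    (ae_of_all _ fun x => ENNReal.ofReal_lt_top)] at h
  refine h.congr ?_
  filter_upwards [ae_restrict_of_ae hw.ae_nonneg] with x hx
  rw [ENNReal.toReal_ofReal hx, smul_eq_mul, mul_comm]

theorem sqrt_setIntegral_le (hw : IsWeight w) (hf : MemLp f 2 (weightMeasure w))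
    (K : Set (Fin n → ℝ)) : √(∫ x in K, f x ^ 2 * w x) ≤ weightedL2Norm w f := by
  refine Real.sqrt_le_iff.2 ⟨ENNReal.toReal_nonneg, ?_⟩
  rw [← hw.integral_sq_mul hf]
  refine setIntegral_le_integral (hw.integrable_sq_mul hf) ?_
  filter_upwards [hw.ae_nonneg] with x hx using mul_nonneg (sq_nonneg _) hx

theorem abs_weightedAvg_le (hw : IsWeight w) (f : (Fin n → ℝ) → ℝ) (E : Set (Fin n → ℝ)) :
    |weightedAvg w f E| ≤ (∫ x in E, |f x| * w x) / ∫ x in E, w x := by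
  have h0 : 0 ≤ ∫ x in E, w x := integral_nonneg_of_ae (ae_restrict_of_ae hw.ae_nonneg)
  rw [weightedAvg, abs_div, abs_of_nonneg h0]
  gcongr
  refine abs_integral_le_integral_abs.trans (integral_congr_ae ?_).le
  filter_upwards [ae_restrict_of_ae hw.ae_nonneg] with x hx
  rw [abs_mul, abs_of_nonneg hx]

end IsWeight

/-! ### From Carleson averages to finite sums, and the theorem -/

theorem sum_le_of_carlesonAverage_le {n : ℕ} {β : DyadicCube n → ℕ → ℝ} {Q' : DyadicCube n}
    {i : ℕ} (hi : i ∈ Finset.Icc 1 (2 ^ n - 1)) {B : ℝ} (hB : 0 ≤ B)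
    (h : carlesonAverage β Q' i ≤ ENNReal.ofReal B) {t : Finset (DyadicCube n × ℕ)}
    (ht : ∀ k ∈ t, k.2 ∈ Finset.Icc 1 (2 ^ n - 1))
    (hsub : ∀ k ∈ t, wilsonSet k.1 k.2 ⊆ wilsonSet Q' i) (hβ : ∀ k ∈ t, 0 ≤ β k.1 k.2) :
    ∑ k ∈ t, β k.1 k.2 ≤ B * volume.real (wilsonSet Q' i) := by
  classical
  obtain ⟨_, c, _, hE, _⟩ := exists_wilsonSet_eq_dyadicBox Q' hi
  have hpos : volume (wilsonSet Q' i) ≠ 0 := hE ▸ (volume_dyadicBox_pos _ c).ne'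
  have hfin : volume (wilsonSet Q' i) ≠ ∞ := hE ▸ (volume_dyadicBox_lt_top _ c).ne
  rw [carlesonAverage, ENNReal.inv_mul_le_iff hpos hfin] at h
  rw [← ENNReal.ofReal_le_ofReal_iff (mul_nonneg hB measureReal_nonneg),
    ENNReal.ofReal_mul hB, ofReal_measureReal hfin, mul_comm,
    ENNReal.ofReal_sum_of_nonneg hβ]
  refine le_trans ?_ h
  rw [tsum_subtype Q'.subcubes fun Q => ∑ j ∈ (Finset.Icc 1 (2 ^ n - 1)).filter
    (fun j => wilsonSet Q j ⊆ wilsonSet Q' i), ENNReal.ofReal (β Q j)]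
  refine le_trans ?_ (ENNReal.sum_le_tsum (t.image Prod.fst))
  -- An arbitrary finite set of pairs is cut out of a product, so that it can be summed cube by
  -- cube.
  have ht' : t = ((t.image Prod.fst) ×ˢ Finset.Icc 1 (2 ^ n - 1)).filter (· ∈ t) := by
    ext k
    simp only [Finset.mem_filter, Finset.mem_product, Finset.mem_image]
    exact ⟨fun hk => ⟨⟨⟨k, hk, rfl⟩, ht k hk⟩, hk⟩, fun hk => hk.2⟩
  calc ∑ k ∈ t, ENNReal.ofReal (β k.1 k.2)
      = ∑ Q ∈ t.image Prod.fst, ∑ j ∈ Finset.Icc 1 (2 ^ n - 1),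
          if (Q, j) ∈ t then ENNReal.ofReal (β Q j) else 0 := by
        conv_lhs => rw [ht']
        rw [Finset.sum_filter, Finset.sum_product]
    _ ≤ _ := Finset.sum_le_sum fun Q hQ => by
        obtain ⟨k, hk, rfl⟩ := Finset.mem_image.1 hQ
        have hmem := mem_subcubes_of_wilsonSet_subset (ht k hk) hi (hsub k hk)
        rw [Set.indicator_of_mem hmem, ← Finset.sum_filter]
        refine Finset.sum_le_sum_of_subset fun j hj => ?_
        obtain ⟨hj, hjt⟩ := Finset.mem_filter.1 hj
        exact Finset.mem_filter.2 ⟨hj, hsub _ hjt⟩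

theorem div_avg_eq {n : ℕ} (a : ℝ) (w : (Fin n → ℝ) → ℝ) (E : Set (Fin n → ℝ)) :
    a / avg w E = a * volume.real E / ∫ x in E, w x := by
  rw [avg, setAverage_eq, smul_eq_mul, div_mul_eq_div_div, div_inv_eq_mul]

theorem theorem4p4 :
    ∃ C : ℝ, 0 < C ∧
      ∀ (n : ℕ) (w v : (Fin n → ℝ) → ℝ) (α : DyadicCube n → ℕ → ℝ) (A : ℝ),
        IsWeight w → IsWeight v →
        (∀ (Q : DyadicCube n), ∀ j ∈ Finset.Icc 1 (2 ^ n - 1), 0 ≤ α Q j) →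
        0 < A →
        (∀ (Q' : DyadicCube n), ∀ i ∈ Finset.Icc 1 (2 ^ n - 1),
          carlesonAverage (fun Q j => α Q j / avg w (wilsonSet Q j)) Q' i
            ≤ ENNReal.ofReal (A * avg v (wilsonSet Q' i))) →
        (∀ (Q' : DyadicCube n), ∀ i ∈ Finset.Icc 1 (2 ^ n - 1),
          carlesonAverage (fun Q j => α Q j / avg v (wilsonSet Q j)) Q' i
            ≤ ENNReal.ofReal (A * avg w (wilsonSet Q' i))) →
        (∀ (Q' : DyadicCube n), ∀ i ∈ Finset.Icc 1 (2 ^ n - 1),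
          carlesonAverage α Q' i ≤ ENNReal.ofReal A) →
        ∀ (f g : (Fin n → ℝ) → ℝ),
          MemLp f 2 (weightMeasure w) → MemLp g 2 (weightMeasure v) →
          ∀ Q' : DyadicCube n,
            Summable (fun Q : Q'.subcubes => ∑ j ∈ Finset.Icc 1 (2 ^ n - 1),
              |α Q.1 j * weightedAvg w f (wilsonSet Q.1 j) * weightedAvg v g (wilsonSet Q.1 j)|) ∧
            ∑' Q : Q'.subcubes, ∑ j ∈ Finset.Icc 1 (2 ^ n - 1),
              α Q.1 j * weightedAvg w f (wilsonSet Q.1 j) * weightedAvg v g (wilsonSet Q.1 j)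
              ≤ C * A * weightedL2Norm w f * weightedL2Norm v g := by
  refine ⟨32, by norm_num, ?_⟩
  intro n w v α A hw hv hα hA H1 H2 H3 f g hf hg Q'
  have hnonneg : 0 ≤ fun Q : Q'.subcubes => ∑ j ∈ Finset.Icc 1 (2 ^ n - 1),
      |α Q.1 j * weightedAvg w f (wilsonSet Q.1 j) * weightedAvg v g (wilsonSet Q.1 j)| :=
    fun Q => Finset.sum_nonneg fun j _ => abs_nonneg _
  have hbound : ∀ u : Finset Q'.subcubes, ∑ Q ∈ u, ∑ j ∈ Finset.Icc 1 (2 ^ n - 1),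
      |α Q.1 j * weightedAvg w f (wilsonSet Q.1 j) * weightedAvg v g (wilsonSet Q.1 j)|
        ≤ 32 * A * weightedL2Norm w f * weightedL2Norm v g := by
    intro u
    set s := (u.map (Function.Embedding.subtype _)) ×ˢ Finset.Icc 1 (2 ^ n - 1) with hs
    have hsj : ∀ k ∈ s, k.2 ∈ Finset.Icc 1 (2 ^ n - 1) := fun k hk => (Finset.mem_product.1 hk).2
    have hsQ : ∀ k ∈ s, k.1 ∈ Q'.subcubes := fun k hk => by
      obtain ⟨Q, _, hQ⟩ := Finset.mem_map.1 (Finset.mem_product.1 hk).1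
      exact hQ ▸ Q.2
    have hbox : ∀ k ∈ s, ∃ κ c, wilsonSet k.1 k.2 = dyadicBox κ c := fun k hk => by
      obtain ⟨_, c, _, hE, _⟩ := exists_wilsonSet_eq_dyadicBox k.1 (hsj k hk)
      exact ⟨_, c, hE⟩
    have hpos : ∀ {w : (Fin n → ℝ) → ℝ}, IsWeight w → ∀ k ∈ s,
        0 < ∫ x in wilsonSet k.1 k.2, w x := fun hw k hk => by
      obtain ⟨κ, c, hE⟩ := hbox k hk
      exact hE ▸ hw.setIntegral_dyadicBox_pos κ c
    have hvol : ∀ k ∈ s, 0 < volume.real (wilsonSet k.1 k.2) := fun k hk => by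
      obtain ⟨κ, c, hE⟩ := hbox k hk
      exact hE ▸ ENNReal.toReal_pos (volume_dyadicBox_pos κ c).ne' (volume_dyadicBox_lt_top κ c).ne
    have hcar : ∀ {w v : (Fin n → ℝ) → ℝ}, IsWeight w → IsWeight v →
        (∀ (Q' : DyadicCube n), ∀ i ∈ Finset.Icc 1 (2 ^ n - 1),
          carlesonAverage (fun Q j => α Q j / avg w (wilsonSet Q j)) Q' i
            ≤ ENNReal.ofReal (A * avg v (wilsonSet Q' i))) →
        ∀ i ∈ s, ∀ t ⊆ s, (∀ k ∈ t, wilsonSet k.1 k.2 ⊆ wilsonSet i.1 i.2) →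
          ∑ k ∈ t, α k.1 k.2 * volume.real (wilsonSet k.1 k.2) / ∫ x in wilsonSet k.1 k.2, w x
            ≤ A * ∫ x in wilsonSet i.1 i.2, v x := by
      intro w v hw hv H i hi t hts ht
      have havg : avg v (wilsonSet i.1 i.2) * volume.real (wilsonSet i.1 i.2)
          = ∫ x in wilsonSet i.1 i.2, v x := by
        rw [avg, setAverage_eq, smul_eq_mul, mul_right_comm, inv_mul_cancel₀ (hvol i hi).ne',
          one_mul]
      have havg0 : 0 ≤ avg v (wilsonSet i.1 i.2) := by
        refine nonneg_of_mul_nonneg_left ?_ (hvol i hi)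
        rw [havg]
        exact (hpos hv i hi).le
      have := sum_le_of_carlesonAverage_le (hsj i hi) (mul_nonneg hA.le havg0)
        (H i.1 i.2 (hsj i hi)) (fun k hk => hsj k (hts hk)) ht (fun k hk => by
          rw [div_avg_eq]
          exact div_nonneg (mul_nonneg (hα _ _ (hsj k (hts hk))) measureReal_nonneg)
            (hpos hw k (hts hk)).le)
      simp only [div_avg_eq] at this
      rwa [mul_assoc, havg] at this
    -- Absolute values make the averages nonnegative and dominate the original terms; the bound does
    -- not depend on `u`, which gives absolute convergence as well.
    have key := laminar_bilinear_embedding (μ := volume) (w := w) (v := v) (f := fun x => |f x|)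
      (g := fun x => |g x|) (fun x => abs_nonneg _) (fun x => abs_nonneg _) hw.ae_nonneg
      hv.ae_nonneg (E := fun k : DyadicCube n × ℕ => wilsonSet k.1 k.2)
      (α := fun k => α k.1 k.2) (ℓ := fun k => volume.real (wilsonSet k.1 k.2)) hA s
      (K := Q'.carrier) (measurableSet_dyadicBox _ _) (hw.integrableOn_dyadicBox _ _)
      (hv.integrableOn_dyadicBox _ _) (hw.integrableOn_mul hf.abs _ _)
      (hv.integrableOn_mul hg.abs _ _) (hw.integrable_sq_mul hf.abs).integrableOn
      (hv.integrable_sq_mul hg.abs).integrableOn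
      (fun k hk => by
        obtain ⟨κ, c, hE⟩ := hbox k hk
        exact hE ▸ measurableSet_dyadicBox κ c)
      (fun k hk => (wilsonSet_subset_carrier k.1 (hsj k hk)).trans (hsQ k hk))
      (fun i hi j hj => wilsonSet_nested_or_disjoint _ _ (hsj i hi) (hsj j hj))
      (hpos hw) (hpos hv) hvol (fun k hk => hα _ _ (hsj k hk))
      (fun i hi t hts ht => sum_le_of_carlesonAverage_le (hsj i hi) hA.le (H3 i.1 i.2 (hsj i hi))
        (fun k hk => hsj k (hts hk)) ht fun k hk => hα _ _ (hsj k (hts hk)))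
      (hcar hv hw H2) (hcar hw hv H1)
    simp only [sq_abs] at key
    have hsum : ∑ Q ∈ u, ∑ j ∈ Finset.Icc 1 (2 ^ n - 1),
        |α Q.1 j * weightedAvg w f (wilsonSet Q.1 j) * weightedAvg v g (wilsonSet Q.1 j)|
        = ∑ k ∈ s, |α k.1 k.2 * weightedAvg w f (wilsonSet k.1 k.2)
            * weightedAvg v g (wilsonSet k.1 k.2)| := by
      rw [hs, Finset.sum_product, Finset.sum_map]
      rfl
    rw [hsum]
    refine (Finset.sum_le_sum fun k hk => ?_).trans (key.trans ?_)
    · have h1 := hw.abs_weightedAvg_le f (wilsonSet k.1 k.2)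
      have h2 := hv.abs_weightedAvg_le g (wilsonSet k.1 k.2)
      have h0 := hα k.1 k.2 (hsj k hk)
      rw [abs_mul, abs_mul, abs_of_nonneg h0]
      exact mul_le_mul (mul_le_mul_of_nonneg_left h1 h0) h2 (abs_nonneg _)
        (mul_nonneg h0 ((abs_nonneg _).trans h1))
    · have h1 := hw.sqrt_setIntegral_le hf Q'.carrier
      have h2 := hv.sqrt_setIntegral_le hg Q'.carrier
      have h3 : 0 ≤ weightedL2Norm w f := ENNReal.toReal_nonneg
      gcongr
  have hsummable := summable_of_sum_le hnonneg hbound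
  have hle : ∀ Q : Q'.subcubes, |∑ j ∈ Finset.Icc 1 (2 ^ n - 1),
      α Q.1 j * weightedAvg w f (wilsonSet Q.1 j) * weightedAvg v g (wilsonSet Q.1 j)|
      ≤ ∑ j ∈ Finset.Icc 1 (2 ^ n - 1),
        |α Q.1 j * weightedAvg w f (wilsonSet Q.1 j) * weightedAvg v g (wilsonSet Q.1 j)| :=
    fun Q => Finset.abs_sum_le_sum_abs _ _
  refine ⟨hsummable, le_trans ?_ (hsummable.tsum_le_of_sum_le hbound)⟩
  exact (Summable.of_norm_bounded hsummable hle).tsum_le_tsum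
    (fun Q => (le_abs_self _).trans (hle Q)) hsummable
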